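/- Let $G$ be a $\sigma$-compact locally compact Hausdorff group with left Haar (Radon) measure $\mu$, let $\mathcal{H}_\pi$ be a complex Hilbert space, and let $\pi : G \to \mathcal{U}(\mathcal{H}_\pi)$ be a unitary representation, i.e. a group homomorphism into the unitary operators such that $x \mapsto \pi(x)g$ is continuous for every $g \in \mathcal{H}_\pi$. For $f, g \in \mathcal{H}_\pi$ write $\mathcal{W}_g f(x) := \langle f, \pi(x) g\rangle$ for $x \in G$, and let $\mathcal{A} := \{ g \in \mathcal{H}_\pi : \mathcal{W}_g g \in L^1(G) \}$, where $L^1(G) = L^1(G,\mu)$. Suppose that $\pi$ is integrable, i.e. that $\{0\}$ and $\mathcal{H}_\pi$ are the only closed $\pi$-invariant subspaces of $\mathcal{H}_\pi$ and that $\mathcal{A} \neq \{0\}$. For $g \in \mathcal{A}\setminus\{0\}$ let \[ \mathcal{H}^1_g := \{ f \in \mathcal{H}_\pi : \mathcal{W}_g f \in L^1(G) \}, \qquad \|f\|_{\mathcal{H}^1_g} := \|\mathcal{W}_g f\|_{L^1(G)} = \int_G |\langle f, \pi(x)g\rangle| \, d\mu(x). \] **Theorem.** For any two vectors $g_1, g_2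 \in \mathcal{A}\setminus\{0\}$ the spaces $\mathcal{H}^1_{g_1}$ and $\mathcal{H}^1_{g_2}$ coincide with equivalent norms: $\mathcal{H}^1_{g_1} = \mathcal{H}^1_{g_2}$ as subspaces of $\mathcal{H}_\pi$, and there are constants $c, C > 0$ such that \[ c\,\|f\|_{\mathcal{H}^1_{g_1}} \le \|f\|_{\mathcal{H}^1_{g_2}} \le C\,\|f\|_{\mathcal{H}^1_{g_1}} \qquad \text{for all } f \in \mathcal{H}^1_{g_1} = \mathcal{H}^1_{g_2}. \] -/

import Mathlib

open MeasureTheory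

/-- A unitary representation of a topological group `G` on a complex Hilbert space `H`: a group
homomorphism `π : G → 𝒰(H)` such that `x ↦ π(x) g` is continuous for every `g ∈ H`. -/
structure UnitaryRep (G H : Type*) [Group G] [TopologicalSpace G]
    [NormedAddCommGroup H] [InnerProductSpace ℂ H] [CompleteSpace H] where
  /-- the homomorphism into the unitary group of `H` -/
  toHom : G →* unitary (H →L[ℂ] H)
  /-- strong continuity -/
  continuous_orbit : ∀ g : H, Continuous fun x : G => (toHom x : H →L[ℂ] H) g

namespace UnitaryRep

section Defs

variable {G H : Type*} [Group G] [TopologicalSpace G]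
  [NormedAddCommGroup H] [InnerProductSpace ℂ H] [CompleteSpace H]

/-- The operator `π(x)` on `H`. -/
noncomputable def op (π : UnitaryRep G H) (x : G) : H →L[ℂ] H := (π.toHom x : H →L[ℂ] H)

/-- A closed subspace `M` of `H` is invariant if `π(x) M ⊆ M` for all `x`; the representation is
irreducible if `{0}` and `H` are its only closed invariant subspaces. -/
def IsIrreducible (π : UnitaryRep G H) : Prop :=
  ∀ M : Submodule ℂ H, IsClosed (M : Set H) → (∀ x : G, ∀ v ∈ M, π.op x v ∈ M) → M = ⊥ ∨ M = ⊤

/-- The wavelet transform `𝒲_g f (x) = ⟨f, π(x) g⟩`. Mathlib's inner product is linear in the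
second argument, so the mathematical `⟨u, v⟩` (linear in `u`) is `inner ℂ v u`. -/
noncomputable def wavelet (π : UnitaryRep G H) (g f : H) (x : G) : ℂ :=
  inner ℂ (π.op x g) f

variable [MeasurableSpace G]

/-- The set `𝒜 = {g ∈ H : 𝒲_g g ∈ L¹(G)}` of analyzing vectors. Its nonzero elements are the
integrable vectors. -/
def analyzing (π : UnitaryRep G H) (μ : Measure G) : Set H :=
  {g | Integrable (π.wavelet g g) μ}

/-- An integrable representation: irreducible, and possessing an integrable vector. -/
def IsIntegrable (π : UnitaryRep G H) (μ : Measure G) : Prop :=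
  π.IsIrreducible ∧ ∃ g ∈ π.analyzing μ, g ≠ 0

/-- The space of test vectors `H¹_g = {f ∈ H : 𝒲_g f ∈ L¹(G)}`, a linear subspace of `H`. -/
noncomputable def testVectors (π : UnitaryRep G H) (μ : Measure G) (g : H) : Submodule ℂ H where
  carrier := {f | Integrable (π.wavelet g f) μ}
  add_mem' {a b} ha hb := by
    have h : π.wavelet g (a + b) = π.wavelet g a + π.wavelet g b := by
      funext x; exact inner_add_right _ _ _
    simpa only [Set.mem_ofPred_eq, h] using Integrable.add ha hb
  zero_mem' := by
    have h : π.wavelet g 0 = fun _ => 0 := by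
      funext x; exact inner_zero_right _
    simp only [Set.mem_ofPred_eq, h]
    exact integrable_zero _ _ _
  smul_mem' c f hf := by
    have h : π.wavelet g (c • f) = fun x => c * π.wavelet g f x := by
      funext x; exact inner_smul_right _ _ _
    simp only [Set.mem_ofPred_eq, h]
    exact Integrable.const_mul hf c

/-- The norm `‖f‖_{H¹_g} = ‖𝒲_g f‖_{L¹(G)} = ∫ |⟨f, π(x) g⟩| dμ(x)` of a test vector
`f ∈ H¹_g`. -/
noncomputable def testNorm (π : UnitaryRep G H) (μ : Measure G) (g : H)
    (f : π.testVectors μ g) : ℝ :=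
  ∫ x, ‖π.wavelet g (f : H) x‖ ∂μ

end Defs

end UnitaryRep

/-! ### Measurability, the Schur test, right translation -/

section General

open MeasureTheory
open scoped ENNReal NNReal

/-! For analyzing `g`, the Schur test bounds `W_g : H → L²(G)`, since the kernel `|⟨π(x)g, π(y)g⟩|`
has all row integrals equal to `‖W_g g‖₁`. For analyzing `g, g'`, the operator `W_{g'}* W_g`
commutes with `π`, so by Schur's lemma it is a scalar `c`. Pairing with `π(y)u` gives a reproducing
formula, and Tonelli yields `|c| ‖W_u f‖₁ ≤ ‖W_u g'‖₁ ‖W_g f‖₁` (`enorm_mul_lintegral_wavelet_le`).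

With `g' = g` one has `c ≠ 0`, and the theorem follows by symmetry once `W_u g ∈ L¹` for analyzing
`u`. This comes from the same inequality with `g' = π(z)u` in place of both `u` and `g'`, and `f =
g`; irreducibility supplies a `z` making that `c` nonzero. -/

lemma Continuous.stronglyMeasurable_of_sigmaCompactSpace {X E : Type*} [TopologicalSpace X]
    [SigmaCompactSpace X] [MeasurableSpace X] [OpensMeasurableSpace X] [NormedAddCommGroup E]
    {f : X → E} (hf : Continuous f) : StronglyMeasurable f := by
  borelize E
  refine stronglyMeasurable_iff_measurable_separable.2 ⟨hf.measurable, ?_⟩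
  -- The range is a countable union of compact sets, hence separable even if `X` is not second
  -- countable.
  rw [← Set.image_univ, ← iUnion_compactCovering X, Set.image_iUnion]
  exact .iUnion fun n => ((isCompact_compactCovering X n).image hf).isSeparable

/-- A **Schur test** for symmetric kernels, as a bound of the quadratic form. -/
lemma lintegral_mul_mul_le {X : Type*} [MeasurableSpace X] (ν : Measure X) [SFinite ν]
    {a : X → ℝ≥0∞} {k : X × X → ℝ≥0∞} (ha : Measurable a) (hk : Measurable k)
    (hsymm : ∀ x y, k (x, y) = k (y, x)) {C : ℝ≥0∞} (hC : ∀ y, ∫⁻ x, k (x, y) ∂ν ≤ C) :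
    ∫⁻ x, ∫⁻ y, a x * a y * k (x, y) ∂ν ∂ν ≤ C * ∫⁻ x, a x ^ 2 ∂ν := by
  have hpt : ∀ s t : ℝ≥0∞, s * t ≤ 2⁻¹ * (s ^ 2 + t ^ 2) := by
    intro s t
    rw [mul_comm 2⁻¹, ← div_eq_mul_inv, ENNReal.le_div_iff_mul_le (by simp) (by simp)]
    rcases eq_or_ne s ∞ with rfl | hs
    · simp
    rcases eq_or_ne t ∞ with rfl | ht
    · simp
    lift s to ℝ≥0 using hs
    lift t to ℝ≥0 using ht
    have := two_mul_le_add_sq s t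
    rw [mul_comm, ← mul_assoc]
    exact_mod_cast this
  have h1 : ∫⁻ x, ∫⁻ y, a x ^ 2 * k (x, y) ∂ν ∂ν ≤ C * ∫⁻ x, a x ^ 2 ∂ν := by
    rw [← lintegral_const_mul _ (ha.pow_const 2)]
    refine lintegral_mono fun x => ?_
    rw [lintegral_const_mul _ (by fun_prop), mul_comm]
    gcongr
    simpa only [hsymm x] using hC x
  have h2 : ∫⁻ x, ∫⁻ y, a y ^ 2 * k (x, y) ∂ν ∂ν ≤ C * ∫⁻ x, a x ^ 2 ∂ν := by
    rw [lintegral_lintegral_swap (by fun_prop)]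
    simpa only [hsymm] using h1
  calc ∫⁻ x, ∫⁻ y, a x * a y * k (x, y) ∂ν ∂ν
      ≤ ∫⁻ x, ∫⁻ y, 2⁻¹ * (a x ^ 2 * k (x, y) + a y ^ 2 * k (x, y)) ∂ν ∂ν := by
        refine lintegral_mono fun x => lintegral_mono fun y => ?_
        simp only [← add_mul, ← mul_assoc]
        exact mul_le_mul' (hpt _ _) le_rfl
    _ = 2⁻¹ * (∫⁻ x, ∫⁻ y, a x ^ 2 * k (x, y) ∂ν ∂ν + ∫⁻ x, ∫⁻ y, a y ^ 2 * k (x, y) ∂ν ∂ν) := by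
        rw [← lintegral_add_left (by fun_prop), ← lintegral_const_mul _ (by fun_prop)]
        refine lintegral_congr fun x => ?_
        rw [← lintegral_add_left (by fun_prop), ← lintegral_const_mul _ (by fun_prop)]
    _ ≤ 2⁻¹ * (C * ∫⁻ x, a x ^ 2 ∂ν + C * ∫⁻ x, a x ^ 2 ∂ν) := by gcongr
    _ = C * ∫⁻ x, a x ^ 2 ∂ν := by
        rw [← two_mul, ← mul_assoc, ENNReal.inv_mul_cancel (by simp) (by simp), one_mul]

/-- By uniqueness of regular Haar measure, right translation only rescales `μ`, so no unimodularity
is needed. -/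
lemma MeasureTheory.Integrable.comp_mul_right_of_regular {G E : Type*} [Group G]
    [TopologicalSpace G] [IsTopologicalGroup G] [LocallyCompactSpace G] [MeasurableSpace G]
    [BorelSpace G] {μ : Measure G} [μ.IsHaarMeasure] [μ.Regular] [NormedAddCommGroup E] {F : G → E} (hF : Integrable F μ) (z : G) : Integrable (fun x => F (x * z)) μ := by
  refine Integrable.comp_measurable (f := fun x => x * z) ?_ (by fun_prop)
  have : (μ.map (· * z)).Regular := Measure.Regular.map (Homeomorph.mulRight z)
  rw [Measure.isMulLeftInvariant_eq_smul_of_regular (μ.map (· * z)) μ]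
  exact hF.smul_measure_nnreal

end General

namespace UnitaryRep

open MeasureTheory
open scoped ENNReal

/-! ### Covariance of the wavelet transform -/

section Algebra

variable {G H : Type*} [Group G] [TopologicalSpace G]
  [NormedAddCommGroup H] [InnerProductSpace ℂ H] [CompleteSpace H]

lemma op_one (π : UnitaryRep G H) : π.op 1 = 1 := by
  simp [op]

lemma op_mul (π : UnitaryRep G H) (x y : G) : π.op (x * y) = π.op x * π.op y := by
  simp [op]

lemma op_mul_apply (π : UnitaryRep G H) (x y : G) (v : H) :
    π.op (x * y) v = π.op x (π.op y v) := by
  rw [op_mul]; rfl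

lemma star_op (π : UnitaryRep G H) (x : G) : star (π.op x) = π.op x⁻¹ := by
  rw [op, op, map_inv]; rfl

lemma inner_op_left (π : UnitaryRep G H) (x : G) (u v : H) :
    inner ℂ (π.op x u) v = inner ℂ u (π.op x⁻¹ v) := by
  rw [← star_op, ContinuousLinearMap.star_eq_adjoint, ContinuousLinearMap.adjoint_inner_right]

lemma inner_op_op (π : UnitaryRep G H) (x : G) (u v : H) :
    inner ℂ (π.op x u) (π.op x v) = inner ℂ u v := by
  rw [inner_op_left, ← op_mul_apply, inv_mul_cancel, op_one]; rfl

lemma norm_op (π : UnitaryRep G H) (x : G) (v : H) : ‖π.op x v‖ = ‖v‖ := by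
  rw [norm_eq_sqrt_re_inner (𝕜 := ℂ), inner_op_op, ← norm_eq_sqrt_re_inner]

/-- The wavelet transform intertwines `π` with left translation. -/
lemma wavelet_op_right (π : UnitaryRep G H) (g f : H) (y x : G) :
    π.wavelet g (π.op y f) x = π.wavelet g f (y⁻¹ * x) := by
  rw [wavelet, wavelet, op_mul_apply, inner_op_left π y⁻¹, inv_inv]

lemma wavelet_op_left (π : UnitaryRep G H) (g f : H) (z x : G) :
    π.wavelet (π.op z g) f x = π.wavelet g f (x * z) := by
  rw [wavelet, wavelet, op_mul_apply]

lemma enorm_wavelet_op_comm (π : UnitaryRep G H) (u v : H) (x y : G) :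
    ‖π.wavelet u (π.op y v) x‖ₑ = ‖π.wavelet v (π.op x u) y‖ₑ := by
  rw [← ofReal_norm, ← ofReal_norm, wavelet, wavelet, norm_inner_symm]

lemma norm_wavelet_le (π : UnitaryRep G H) (g f : H) (x : G) :
    ‖π.wavelet g f x‖ ≤ ‖g‖ * ‖f‖ := by
  rw [← norm_op π x g]
  exact norm_inner_le_norm _ _

lemma continuous_op_apply (π : UnitaryRep G H) (g : H) : Continuous fun x => π.op x g :=
  π.continuous_orbit g

lemma continuous_wavelet (π : UnitaryRep G H) (g f : H) : Continuous (π.wavelet g f) :=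
  (π.continuous_op_apply g).inner continuous_const

/-- Left invariance makes the integral independent of `y`: this is the row bound for the Schur test.
-/
lemma lintegral_enorm_inner_op_op [IsTopologicalGroup G]
    [MeasurableSpace G] [BorelSpace G] (π : UnitaryRep G H) (μ : Measure G) [μ.IsMulLeftInvariant]
    (u v : H) (y : G) :
    ∫⁻ x, ‖(inner ℂ (π.op x u) (π.op y v) : ℂ)‖ₑ ∂μ = ∫⁻ x, ‖π.wavelet u v x‖ₑ ∂μ := by
  rw [← lintegral_mul_left_eq_self (fun x => ‖π.wavelet u v x‖ₑ) y⁻¹]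
  exact lintegral_congr fun x => by rw [← wavelet_op_right]; rfl

end Algebra

/-! ### Schur's lemma -/

section Schur

variable {G H : Type*} [Group G] [TopologicalSpace G]
  [NormedAddCommGroup H] [InnerProductSpace ℂ H] [CompleteSpace H]

/-- If a product of two operators in the commutant of an irreducible representation vanishes, then
so does one of the factors. -/
lemma IsIrreducible.eq_zero_or_eq_zero_of_mul_eq_zero {π : UnitaryRep G H} (hπ : π.IsIrreducible)
    {A B : H →L[ℂ] H} (hA : ∀ x, Commute (π.op x) A) (hAB : A * B = 0) : A = 0 ∨ B = 0 := by
  rcases hπ (LinearMap.ker (A : H →ₗ[ℂ] H)) A.isClosed_ker (fun x v hv => by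
    have h := congrArg (fun S : H →L[ℂ] H => S v) (hA x).eq
    simp only [mul_apply_eq_comp] at h
    have hv' : A v = 0 := hv
    change A (π.op x v) = 0
    rw [← h, hv', map_zero]) with h | h
  · right
    ext v
    have : B v ∈ LinearMap.ker (A : H →ₗ[ℂ] H) :=
      congrArg (fun S : H →L[ℂ] H => S v) hAB
    rw [h] at this
    simpa using this
  · left
    ext v
    have : v ∈ LinearMap.ker (A : H →ₗ[ℂ] H) := by rw [h]; trivial
    exact this

lemma IsIrreducible.exists_eq_smul_one_of_isSelfAdjoint {π : UnitaryRep G H}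
    (hπ : π.IsIrreducible) {T : H →L[ℂ] H} (hT : IsSelfAdjoint T)
    (hc : ∀ x, Commute (π.op x) T) : ∃ c : ℂ, T = c • 1 := by
  -- Two spectral points would be separated by the cutoffs `(x - m)⁺` and `(m - x)⁺`: nonzero
  -- elements of the commutant with product zero.
  have key : ∀ a ∈ spectrum ℝ T, ∀ b ∈ spectrum ℝ T, ¬ a < b := by
    intro a ha b hb hab
    set m := (a + b) / 2 with hm
    have hf : Continuous fun x : ℝ => max (x - m) 0 := by fun_prop
    have hg : Continuous fun x : ℝ => max (m - x) 0 := by fun_prop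
    have hmul : cfc (fun x : ℝ => max (x - m) 0) T * cfc (fun x : ℝ => max (m - x) 0) T = 0 := by
      rw [← cfc_mul _ _ T hf.continuousOn hg.continuousOn, ← cfc_zero (R := ℝ) (a := T)]
      refine cfc_congr fun x _ => ?_
      rcases le_total x m with h | h
      · simp [max_eq_right (sub_nonpos.2 h)]
      · simp [max_eq_right (sub_nonpos.2 h)]
    have hne : ∀ f : ℝ → ℝ, Continuous f → ∀ t ∈ spectrum ℝ T, cfc f T = 0 → f t = 0 := by
      intro f hf t ht h0
      have h : cfc f T = cfc (fun _ : ℝ => (0 : ℝ)) T := by rw [h0, cfc_const_zero]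
      exact (cfc_eq_cfc_iff_eqOn (p := IsSelfAdjoint) (ha := hT) (hf := hf.continuousOn)
        (hg := continuousOn_const)).1 h ht
    rcases hπ.eq_zero_or_eq_zero_of_mul_eq_zero
      (fun x => (hT.commute_cfc (hc x).symm _).symm) hmul with h | h
    · have := hne _ hf b hb h
      have h2 : b - m ≤ 0 := this ▸ le_max_left _ _
      linarith
    · have := hne _ hg a ha h
      have h2 : m - a ≤ 0 := this ▸ le_max_left _ _
      linarith
  obtain ⟨c, hcs⟩ : ∃ c : ℝ, ∀ t ∈ spectrum ℝ T, t = c := by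
    rcases (spectrum ℝ T).eq_empty_or_nonempty with h | ⟨c, h⟩
    · exact ⟨0, by simp [h]⟩
    · exact ⟨c, fun t ht => le_antisymm (not_lt.1 (key c h t ht)) (not_lt.1 (key t ht c h))⟩
  refine ⟨c, ?_⟩
  calc T = cfc (fun x : ℝ => x) T := (cfc_id' ℝ T).symm
    _ = cfc (fun _ : ℝ => c) T := cfc_congr fun t ht => hcs t ht
    _ = (c : ℂ) • 1 := by
      rw [cfc_const c T, Algebra.algebraMap_eq_smul_one]; rfl

/-- **Schur's lemma**: the commutant of an irreducible representation consists of scalars. -/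
lemma IsIrreducible.exists_eq_smul_one {π : UnitaryRep G H} (hπ : π.IsIrreducible)
    {T : H →L[ℂ] H} (hc : ∀ x, Commute (π.op x) T) : ∃ c : ℂ, T = c • 1 := by
  have hs : ∀ x, Commute (π.op x) (star T) := fun x => by
    have := (hc x⁻¹).star_star
    rwa [star_op, inv_inv] at this
  obtain ⟨a, ha⟩ := hπ.exists_eq_smul_one_of_isSelfAdjoint (realPart T).2 fun x => by
    rw [realPart_apply_coe]
    exact ((hc x).add_right (hs x)).smul_right _
  obtain ⟨b, hb⟩ := hπ.exists_eq_smul_one_of_isSelfAdjoint (imaginaryPart T).2 fun x => by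
    rw [imaginaryPart_apply_coe]
    exact (((hc x).sub_right (hs x)).smul_right _).smul_right _
  refine ⟨a + Complex.I * b, ?_⟩
  rw [← realPart_add_I_smul_imaginaryPart T, ha, hb, add_smul, mul_smul]

end Schur

/-! ### Square integrability and orthogonality relations -/

section L2

variable {G H : Type*} [Group G] [TopologicalSpace G] [SigmaCompactSpace G] [MeasurableSpace G]
  [BorelSpace G]
  [NormedAddCommGroup H] [InnerProductSpace ℂ H] [CompleteSpace H]

lemma stronglyMeasurable_wavelet (π : UnitaryRep G H) (g f : H) :
    StronglyMeasurable (π.wavelet g f) :=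
  (π.continuous_wavelet g f).stronglyMeasurable_of_sigmaCompactSpace

/-- Joint measurability for the product `σ`-algebra, which may be smaller than the Borel one. -/
lemma stronglyMeasurable_inner_op_op (π : UnitaryRep G H) (u v : H) :
    StronglyMeasurable fun p : G × G => (inner ℂ (π.op p.1 u) (π.op p.2 v) : ℂ) :=
  ((π.continuous_op_apply u).stronglyMeasurable_of_sigmaCompactSpace.comp_measurable
    measurable_fst).inner
    ((π.continuous_op_apply v).stronglyMeasurable_of_sigmaCompactSpace.comp_measurable
      measurable_snd)

lemma measurable_enorm_inner_op_op (π : UnitaryRep G H) (u v : H) :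
    Measurable fun p : G × G => ‖(inner ℂ (π.op p.1 u) (π.op p.2 v) : ℂ)‖ₑ :=
  (π.stronglyMeasurable_inner_op_op u v).enorm

variable [IsTopologicalGroup G]

/-- `W_g` satisfies an `L²` bound on each set of finite measure. -/
lemma lintegral_restrict_enorm_wavelet_sq_le (π : UnitaryRep G H) (μ : Measure G)
    [μ.IsMulLeftInvariant] [SFinite μ] (g f : H) (K : Set G) (hK : μ K ≠ ∞) :
    ∫⁻ x in K, ‖π.wavelet g f x‖ₑ ^ 2 ∂μ ≤ (∫⁻ x, ‖π.wavelet g g x‖ₑ ∂μ) * ‖f‖ₑ ^ 2 := by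
  set ν := μ.restrict K with hν
  have : IsFiniteMeasure ν := ⟨by rw [hν, Measure.restrict_apply_univ]; exact hK.lt_top⟩
  set C := ∫⁻ x, ‖π.wavelet g g x‖ₑ ∂μ with hC
  set E := ∫⁻ x, ‖π.wavelet g f x‖ₑ ^ 2 ∂ν with hE
  -- `v = ∫_K Φ` is the truncated synthesis of `f`: `⟨v, f⟩ = E`, and expanding `‖v‖²` produces the
  -- Schur kernel.
  set Φ : G → H := fun x => π.wavelet g f x • π.op x g with hΦ
  have hΦm : StronglyMeasurable Φ := (π.stronglyMeasurable_wavelet g f).smul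
    (π.continuous_op_apply g).stronglyMeasurable_of_sigmaCompactSpace
  have hΦi : Integrable Φ ν := by
    refine Integrable.of_bound hΦm.aestronglyMeasurable (‖g‖ * ‖f‖ * ‖g‖) (.of_forall fun x => ?_)
    rw [hΦ, norm_smul, norm_op]
    gcongr
    exact π.norm_wavelet_le g f x
  set v := ∫ x, Φ x ∂ν with hv
  have hE' : E ≤ ‖f‖ₑ * ‖v‖ₑ := by
    have h1 : inner ℂ f v = ∫ x, ((‖π.wavelet g f x‖ ^ 2 : ℝ) : ℂ) ∂ν := by
      rw [hv, ← integral_inner hΦi]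
      refine integral_congr_ae (.of_forall fun x => ?_)
      simp only [hΦ, inner_smul_right]
      rw [← inner_conj_symm f]
      change π.wavelet g f x * (starRingEnd ℂ) (π.wavelet g f x) = _
      rw [Complex.mul_conj, Complex.normSq_eq_norm_sq]
    have h2 : E = ‖(inner ℂ f v : ℂ)‖ₑ := by
      rw [h1, integral_complex_ofReal, ← ofReal_norm, Complex.norm_real, Real.norm_eq_abs,
        abs_of_nonneg (integral_nonneg fun x => by positivity),
        ofReal_integral_eq_lintegral_ofReal]
      · refine lintegral_congr fun x => ?_
        rw [ENNReal.ofReal_pow (norm_nonneg _), ofReal_norm]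
      · refine Integrable.of_bound ?_ ((‖g‖ * ‖f‖) ^ 2) (.of_forall fun x => ?_)
        · exact ((π.stronglyMeasurable_wavelet g f).norm.pow 2).aestronglyMeasurable
        · rw [Real.norm_of_nonneg (by positivity)]
          gcongr
          exact π.norm_wavelet_le g f x
      · exact .of_forall fun x => by positivity
    rw [h2]
    rw [← ofReal_norm, ← ofReal_norm, ← ofReal_norm, ← ENNReal.ofReal_mul (norm_nonneg _)]
    exact ENNReal.ofReal_le_ofReal (norm_inner_le_norm _ _)
  have hvE : ‖v‖ₑ ^ 2 ≤ C * E := by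
    have h1 : ‖v‖ₑ ^ 2 = ‖(inner ℂ v v : ℂ)‖ₑ := by
      rw [inner_self_eq_norm_sq_to_K, enorm_pow, ← ofReal_norm, ← ofReal_norm, RCLike.norm_ofReal,
        abs_norm]
    have h2 : ∀ u : H, ‖(inner ℂ u v : ℂ)‖ₑ ≤ ∫⁻ y, ‖(inner ℂ u (Φ y) : ℂ)‖ₑ ∂ν := fun u => by
      rw [hv, ← integral_inner hΦi]
      exact enorm_integral_le_lintegral_enorm _
    calc ‖v‖ₑ ^ 2 ≤ ∫⁻ x, ‖(inner ℂ v (Φ x) : ℂ)‖ₑ ∂ν := h1 ▸ h2 v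
      _ = ∫⁻ x, ‖(inner ℂ (Φ x) v : ℂ)‖ₑ ∂ν := by
        refine lintegral_congr fun x => ?_
        rw [← ofReal_norm, ← ofReal_norm, norm_inner_symm]
      _ ≤ ∫⁻ x, ∫⁻ y, ‖(inner ℂ (Φ x) (Φ y) : ℂ)‖ₑ ∂ν ∂ν := by
        gcongr with x
        exact h2 _
      _ = ∫⁻ x, ∫⁻ y, ‖π.wavelet g f x‖ₑ * ‖π.wavelet g f y‖ₑ *
            ‖(inner ℂ (π.op x g) (π.op y g) : ℂ)‖ₑ ∂ν ∂ν := by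
        refine lintegral_congr fun x => lintegral_congr fun y => ?_
        simp only [hΦ, inner_smul_right, inner_smul_left, enorm_mul, RCLike.enorm_conj]
        ring
      _ ≤ C * E := by
        refine lintegral_mul_mul_le ν (a := fun x => ‖π.wavelet g f x‖ₑ)
          (π.stronglyMeasurable_wavelet g f).enorm
          (π.measurable_enorm_inner_op_op g g) (fun x y => ?_) fun y => ?_
        · simp only
          rw [← ofReal_norm, ← ofReal_norm, norm_inner_symm]
        · exact (lintegral_mono' Measure.restrict_le_self le_rfl).trans
            (π.lintegral_enorm_inner_op_op μ g g y).le
  -- Restricting to finite measure serves to make `E` finite, so it can be cancelled from `E² ≤ C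
  -- ‖f‖² E`.
  have hEtop : E ≠ ∞ := by
    refine ne_top_of_le_ne_top ?_ hE'
    finiteness
  rcases eq_or_ne E 0 with h0 | h0
  · rw [h0]; exact zero_le
  have h3 : E * E ≤ (C * ‖f‖ₑ ^ 2) * E := by
    calc E * E ≤ (‖f‖ₑ * ‖v‖ₑ) * (‖f‖ₑ * ‖v‖ₑ) := by gcongr
      _ = ‖f‖ₑ ^ 2 * ‖v‖ₑ ^ 2 := by ring
      _ ≤ ‖f‖ₑ ^ 2 * (C * E) := by gcongr
      _ = (C * ‖f‖ₑ ^ 2) * E := by ring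
  exact (ENNReal.mul_le_mul_iff_left h0 hEtop).1 h3

lemma lintegral_enorm_wavelet_sq_le (π : UnitaryRep G H) (μ : Measure G)
    [μ.IsMulLeftInvariant] [IsFiniteMeasureOnCompacts μ] (g f : H) :
    ∫⁻ x, ‖π.wavelet g f x‖ₑ ^ 2 ∂μ ≤ (∫⁻ x, ‖π.wavelet g g x‖ₑ ∂μ) * ‖f‖ₑ ^ 2 := by
  rw [← setLIntegral_univ, ← iUnion_compactCovering G, setLIntegral_iUnion_of_directed _
    (directed_of_isDirected_le fun _ _ h => compactCovering_subset G h)]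
  exact iSup_le fun n => π.lintegral_restrict_enorm_wavelet_sq_le μ g f _
    (isCompact_compactCovering G n).measure_lt_top.ne

variable {μ : Measure G} [μ.IsMulLeftInvariant] [IsFiniteMeasureOnCompacts μ]

lemma eLpNorm_wavelet_le {π : UnitaryRep G H} {g : H} (hg : g ∈ π.analyzing μ) (f : H) :
    eLpNorm (π.wavelet g f) 2 μ ≤
      ENNReal.ofReal (√(∫ x, ‖π.wavelet g g x‖ ∂μ) * ‖f‖) := by
  have h := π.lintegral_enorm_wavelet_sq_le μ g f
  rw [eLpNorm_eq_lintegral_rpow_enorm_toReal (by simp) (by simp)]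
  simp only [ENNReal.toReal_ofNat, ENNReal.rpow_ofNat, one_div]
  rw [ENNReal.rpow_inv_le_iff (by norm_num), ENNReal.rpow_ofNat,
    ← ENNReal.ofReal_pow (by positivity), mul_pow, Real.sq_sqrt (by positivity),
    ENNReal.ofReal_mul (by positivity), ofReal_integral_norm_eq_lintegral_enorm hg,
    ENNReal.ofReal_pow (by positivity), ofReal_norm]
  exact h

lemma memLp_wavelet {π : UnitaryRep G H} {g : H} (hg : g ∈ π.analyzing μ) (f : H) :
    MemLp (π.wavelet g f) 2 μ :=
  ⟨(π.stronglyMeasurable_wavelet g f).aestronglyMeasurable,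
    (eLpNorm_wavelet_le hg f).trans_lt ENNReal.ofReal_lt_top⟩

/-- The wavelet transform of an analyzing vector as a bounded operator into `L²(G)`. -/
noncomputable def waveletL2 (π : UnitaryRep G H) {g : H} (hg : g ∈ π.analyzing μ) :
    H →L[ℂ] Lp ℂ 2 μ :=
  LinearMap.mkContinuous
    { toFun := fun f => (memLp_wavelet hg f).toLp
      map_add' := fun a b => by
        rw [← MemLp.toLp_add]
        congr 1
        funext x; exact inner_add_right _ _ _
      map_smul' := fun c a => by
        rw [RingHom.id_apply, ← MemLp.toLp_const_smul]
        congr 1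
        funext x; exact inner_smul_right _ _ _ }
    (√(∫ x, ‖π.wavelet g g x‖ ∂μ)) fun f => by
      rw [LinearMap.coe_mk, AddHom.coe_mk, Lp.norm_toLp]
      exact ENNReal.toReal_le_of_le_ofReal (by positivity) (eLpNorm_wavelet_le hg f)

lemma inner_waveletL2 (π : UnitaryRep G H) {g g' : H} (hg : g ∈ π.analyzing μ)
    (hg' : g' ∈ π.analyzing μ) (f h : H) :
    inner ℂ (π.waveletL2 hg' h) (π.waveletL2 hg f) =
      ∫ x, inner ℂ (π.wavelet g' h x) (π.wavelet g f x) ∂μ := by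
  rw [L2.inner_def]
  refine integral_congr_ae ?_
  filter_upwards [(memLp_wavelet hg' h).coeFn_toLp, (memLp_wavelet hg f).coeFn_toLp] with x h1 h2
  change inner ℂ ((memLp_wavelet hg' h).toLp _ x) ((memLp_wavelet hg f).toLp _ x) = _
  rw [h1, h2]

/-- The orthogonality relations, with an unspecified constant. -/
lemma exists_integral_inner_wavelet_eq {π : UnitaryRep G H} (hπ : π.IsIrreducible) {g g' : H}
    (hg : g ∈ π.analyzing μ) (hg' : g' ∈ π.analyzing μ) :
    ∃ c : ℂ, ∀ f h : H,
      ∫ x, inner ℂ (π.wavelet g' h x) (π.wavelet g f x) ∂μ = c * inner ℂ h f := by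
  set T : H →L[ℂ] H := (π.waveletL2 hg').adjoint ∘L π.waveletL2 hg with hT
  have hTi : ∀ f h : H, inner ℂ h (T f) =
      ∫ x, inner ℂ (π.wavelet g' h x) (π.wavelet g f x) ∂μ := fun f h => by
    rw [← π.inner_waveletL2 hg hg', hT, ContinuousLinearMap.comp_apply,
      ContinuousLinearMap.adjoint_inner_right]
  obtain ⟨c, hc⟩ := hπ.exists_eq_smul_one (T := T) fun y => by
    refine ContinuousLinearMap.ext fun f => ext_inner_left ℂ fun h => ?_
    rw [mul_apply_eq_comp, mul_apply_eq_comp, hTi,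
      ← inv_inv y, ← inner_op_left, hTi, inv_inv]
    simp only [wavelet_op_right, inv_inv]
    -- The substitution `x ↦ y * x` moves the translation from one factor to the other.
    rw [← integral_mul_left_eq_self (μ := μ)
      (fun x => inner ℂ (π.wavelet g' h x) (π.wavelet g f (y⁻¹ * x))) y]
    refine integral_congr_ae (.of_forall fun x => ?_)
    simp
  refine ⟨c, fun f h => ?_⟩
  rw [← hTi, hc]
  simp

/-- The reproducing formula expresses `W_u f` as the convolution of `W_g f` and `W_u g'`, up to
the constant of the orthogonality relations. -/
lemma enorm_mul_lintegral_wavelet_le (π : UnitaryRep G H) {g g' : H} {c : ℂ}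
    (hc : ∀ f h : H,
      ∫ x, inner ℂ (π.wavelet g' h x) (π.wavelet g f x) ∂μ = c * inner ℂ h f) (u f : H) :
    ‖c‖ₑ * ∫⁻ x, ‖π.wavelet u f x‖ₑ ∂μ ≤
      (∫⁻ x, ‖π.wavelet u g' x‖ₑ ∂μ) * ∫⁻ x, ‖π.wavelet g f x‖ₑ ∂μ := by
  have hm : ∀ a b : H, Measurable fun x => ‖π.wavelet a b x‖ₑ := fun a b =>
    (π.stronglyMeasurable_wavelet a b).enorm
  have hk := π.measurable_enorm_inner_op_op u g'
  calc ‖c‖ₑ * ∫⁻ y, ‖π.wavelet u f y‖ₑ ∂μ = ∫⁻ y, ‖c * π.wavelet u f y‖ₑ ∂μ := by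
        rw [← lintegral_const_mul _ (hm u f)]
        simp only [enorm_mul]
    _ ≤ ∫⁻ y, ∫⁻ x, ‖(inner ℂ (π.op y u) (π.op x g') : ℂ)‖ₑ * ‖π.wavelet g f x‖ₑ ∂μ ∂μ := by
        refine lintegral_mono fun y => ?_
        rw [wavelet, ← hc]
        refine (enorm_integral_le_lintegral_enorm _).trans (lintegral_mono fun x => ?_)
        rw [RCLike.inner_apply', enorm_mul, RCLike.enorm_conj, enorm_wavelet_op_comm]
        rfl
    _ = ∫⁻ x, ∫⁻ y, ‖(inner ℂ (π.op y u) (π.op x g') : ℂ)‖ₑ * ‖π.wavelet g f x‖ₑ ∂μ ∂μ :=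
        lintegral_lintegral_swap (hk.mul ((hm g f).comp measurable_snd)).aemeasurable
    _ = (∫⁻ x, ‖π.wavelet u g' x‖ₑ ∂μ) * ∫⁻ x, ‖π.wavelet g f x‖ₑ ∂μ := by
        rw [← lintegral_const_mul _ (hm g f)]
        refine lintegral_congr fun x => ?_
        rw [lintegral_mul_const _ (by fun_prop), lintegral_enorm_inner_op_op]

/-- The continuous function `W_g g` takes the value `‖g‖² ≠ 0` at `1`, so it cannot vanish almost
everywhere. -/
lemma integral_inner_wavelet_self_ne_zero {π : UnitaryRep G H} [μ.IsOpenPosMeasure] {g : H}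
    (hg : g ∈ π.analyzing μ) (hg0 : g ≠ 0) :
    ∫ x, inner ℂ (π.wavelet g g x) (π.wavelet g g x) ∂μ ≠ 0 := by
  rw [← π.inner_waveletL2 hg hg, inner_self_ne_zero]
  intro h
  have h1 : π.wavelet g g =ᵐ[μ] fun _ => 0 :=
    (memLp_wavelet hg g).coeFn_toLp.symm.trans (by
      rw [show (memLp_wavelet hg g).toLp = 0 from h]; exact Lp.coeFn_zero _ _ _)
  have h2 := congrFun ((π.continuous_wavelet g g).ae_eq_iff_eq μ continuous_const |>.1 h1) 1
  rw [wavelet, op_one] at h2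
  exact hg0 (inner_self_eq_zero.1 h2)

/-- Some translate of a nonzero vector `u` is not orthogonal to `g` in the sense of the
orthogonality relations. -/
lemma exists_integral_inner_wavelet_ne_zero {π : UnitaryRep G H} [μ.IsOpenPosMeasure]
    (hπ : π.IsIrreducible) {g u : H} (hg : g ∈ π.analyzing μ) (hg0 : g ≠ 0) (hu : u ≠ 0) :
    ∃ z, ∫ x, inner ℂ (π.wavelet (π.op z u) g x) (π.wavelet g g x) ∂μ ≠ 0 := by
  by_contra! hcon
  have hint : ∀ v, Integrable (fun x => (inner ℂ (π.wavelet v g x) (π.wavelet g g x) : ℂ)) μ := by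
    intro v
    refine (hg.norm.const_mul (‖v‖ * ‖g‖)).mono' ?_ (.of_forall fun x => ?_)
    · exact ((π.stronglyMeasurable_wavelet v g).inner
        (π.stronglyMeasurable_wavelet g g)).aestronglyMeasurable
    · refine (norm_inner_le_norm _ _).trans ?_
      gcongr
      exact π.norm_wavelet_le v g x
  -- Defined for every `v`, analyzing or not, because `W_v g` is bounded and `W_g g` is integrable.
  -- The two conjugations cancel, so `L` is linear.
  let L : H →L[ℂ] ℂ := LinearMap.mkContinuous
    { toFun := fun v => ∫ x, inner ℂ (π.wavelet v g x) (π.wavelet g g x) ∂μ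
      map_add' := fun a b => by
        rw [← integral_add (hint a) (hint b)]
        refine integral_congr_ae (.of_forall fun x => ?_)
        simp only [wavelet, map_add, inner_add_left]
      map_smul' := fun c a => by
        rw [RingHom.id_apply, smul_eq_mul, ← integral_const_mul]
        refine integral_congr_ae (.of_forall fun x => ?_)
        simp only [wavelet, map_smul, inner_smul_left, RCLike.inner_apply', map_mul,
          Complex.conj_conj, mul_assoc] }
    (‖g‖ * ∫ x, ‖π.wavelet g g x‖ ∂μ) fun v => by
      rw [LinearMap.coe_mk, AddHom.coe_mk, mul_right_comm, ← integral_const_mul]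
      refine norm_integral_le_of_norm_le (hg.norm.const_mul _) (.of_forall fun x => ?_)
      refine (norm_inner_le_norm _ _).trans ?_
      gcongr
      exact (π.norm_wavelet_le v g x).trans_eq (mul_comm _ _)
  -- A closed invariant subspace; it would contain `u ≠ 0`, hence `g`, against `L g ≠ 0`.
  let M : Submodule ℂ H := ⨅ z, LinearMap.ker ((L ∘L π.op z : H →L[ℂ] ℂ) : H →ₗ[ℂ] ℂ)
  have hM : ∀ v, v ∈ M ↔ ∀ z, L (π.op z v) = 0 := fun v => by simp [M, Submodule.mem_iInf]
  have hcl : IsClosed (M : Set H) := by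
    rw [Submodule.coe_iInf]
    exact isClosed_iInter fun z => (L ∘L π.op z).isClosed_ker
  rcases hπ M hcl fun x v hv => (hM _).2 fun z => by
    rw [← op_mul_apply]; exact (hM v).1 hv _ with h | h
  · have : u ∈ M := (hM u).2 hcon
    rw [h] at this
    exact hu this
  · have : g ∈ M := by rw [h]; trivial
    have := (hM g).1 this 1
    rw [op_one] at this
    exact integral_inner_wavelet_self_ne_zero hg hg0 this

end L2

/-! ### Integrability and norm comparison -/

section L1

variable {G H : Type*} [Group G] [TopologicalSpace G] [IsTopologicalGroup G]
  [LocallyCompactSpace G] [MeasurableSpace G] [BorelSpace G]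
  [NormedAddCommGroup H] [InnerProductSpace ℂ H] [CompleteSpace H]
  {μ : Measure G} [μ.IsHaarMeasure] [μ.Regular]

lemma op_mem_analyzing {π : UnitaryRep G H} {g : H} (hg : g ∈ π.analyzing μ) (z : G) :
    π.op z g ∈ π.analyzing μ := by
  have h : π.wavelet (π.op z g) (π.op z g) = fun x => π.wavelet g g (z⁻¹ * (x * z)) := by
    funext x
    rw [wavelet_op_left, wavelet_op_right]
  change Integrable _ μ
  rw [h]
  exact (hg.comp_mul_left z⁻¹).comp_mul_right_of_regular z

variable [SigmaCompactSpace G]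

/-- Replacing `u` by `π(z)u` makes the orthogonality constant nonzero and only right-translates `W_u
g`, which is undone at the end. -/
lemma integrable_wavelet_of_mem_analyzing {π : UnitaryRep G H} (hπ : π.IsIrreducible) {g u : H}
    (hg : g ∈ π.analyzing μ) (hg0 : g ≠ 0) (hu : u ∈ π.analyzing μ) (hu0 : u ≠ 0) :
    Integrable (π.wavelet u g) μ := by
  obtain ⟨z, hz⟩ := exists_integral_inner_wavelet_ne_zero hπ hg hg0 hu0
  have hzu := op_mem_analyzing hu z
  obtain ⟨c, hc⟩ := exists_integral_inner_wavelet_eq hπ hg hzu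
  have hc0 : c ≠ 0 := fun h => hz (by rw [hc, h, zero_mul])
  have hfin := (π.enorm_mul_lintegral_wavelet_le hc (π.op z u) g).trans_lt
    (ENNReal.mul_lt_top (hasFiniteIntegral_iff_enorm.1 hzu.2) (hasFiniteIntegral_iff_enorm.1 hg.2))
  have hi : Integrable (π.wavelet (π.op z u) g) μ :=
    ⟨(π.stronglyMeasurable_wavelet _ _).aestronglyMeasurable, hasFiniteIntegral_iff_enorm.2
      (ENNReal.lt_top_of_mul_ne_top_right hfin.ne (by simpa using hc0))⟩
  refine (hi.comp_mul_right_of_regular z⁻¹).congr (.of_forall fun x => ?_)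
  simp only [wavelet_op_left, inv_mul_cancel_right]

lemma exists_lintegral_wavelet_le {π : UnitaryRep G H} (hπ : π.IsIrreducible) {g u : H}
    (hg : g ∈ π.analyzing μ) (hg0 : g ≠ 0) (hu : u ∈ π.analyzing μ) (hu0 : u ≠ 0) :
    ∃ C : ℝ, 0 < C ∧ ∀ f, Integrable (π.wavelet g f) μ → Integrable (π.wavelet u f) μ ∧
      ∫ x, ‖π.wavelet u f x‖ ∂μ ≤ C * ∫ x, ‖π.wavelet g f x‖ ∂μ := by
  obtain ⟨c, hc⟩ := exists_integral_inner_wavelet_eq hπ hg hg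
  have hc0 : c ≠ 0 := fun h =>
    integral_inner_wavelet_self_ne_zero hg hg0 (by rw [hc, h, zero_mul])
  have hi := integrable_wavelet_of_mem_analyzing hπ hg hg0 hu hu0
  have hA : 0 ≤ ∫ x, ‖π.wavelet u g x‖ ∂μ := by positivity
  -- The natural constant is `‖W_u g‖₁ / |c|`; the `+ 1` gives positivity without proving `W_u g ≠
  -- 0`.
  refine ⟨((∫ x, ‖π.wavelet u g x‖ ∂μ) + 1) / ‖c‖, by positivity, fun f hf => ?_⟩
  have hle := π.enorm_mul_lintegral_wavelet_le hc u f
  have huf : Integrable (π.wavelet u f) μ :=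
    ⟨(π.stronglyMeasurable_wavelet _ _).aestronglyMeasurable, hasFiniteIntegral_iff_enorm.2
      (ENNReal.lt_top_of_mul_ne_top_right (hle.trans_lt (ENNReal.mul_lt_top
        (hasFiniteIntegral_iff_enorm.1 hi.2) (hasFiniteIntegral_iff_enorm.1 hf.2))).ne
        (by simpa using hc0))⟩
  refine ⟨huf, ?_⟩
  rw [← ofReal_integral_norm_eq_lintegral_enorm hf, ← ofReal_integral_norm_eq_lintegral_enorm hi,
    ← ofReal_integral_norm_eq_lintegral_enorm huf, ← ofReal_norm,
    ← ENNReal.ofReal_mul (by positivity), ← ENNReal.ofReal_mul (by positivity),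
    ENNReal.ofReal_le_ofReal_iff (by positivity)] at hle
  rw [div_mul_eq_mul_div, le_div_iff₀ (by positivity), mul_comm]
  refine hle.trans ?_
  gcongr
  linarith

end L1

end UnitaryRep

theorem mainTheorem2 {G H : Type*}
    [Group G] [TopologicalSpace G] [IsTopologicalGroup G] [T2Space G] [LocallyCompactSpace G]
    [SigmaCompactSpace G] [MeasurableSpace G] [BorelSpace G]
    (μ : MeasureTheory.Measure G) [μ.IsHaarMeasure] [μ.Regular]
    [NormedAddCommGroup H] [InnerProductSpace ℂ H] [CompleteSpace H]
    (π : UnitaryRep G H) (hπ : π.IsIntegrable μ)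
    (g₁ g₂ : H) (hg₁ : g₁ ∈ π.analyzing μ) (hg₁_ne : g₁ ≠ 0)
    (hg₂ : g₂ ∈ π.analyzing μ) (hg₂_ne : g₂ ≠ 0) :
    π.testVectors μ g₁ = π.testVectors μ g₂ ∧
      ∃ c C : ℝ, 0 < c ∧ 0 < C ∧
        ∀ (f : H) (hf₁ : f ∈ π.testVectors μ g₁) (hf₂ : f ∈ π.testVectors μ g₂),
          c * π.testNorm μ g₁ ⟨f, hf₁⟩ ≤ π.testNorm μ g₂ ⟨f, hf₂⟩ ∧
            π.testNorm μ g₂ ⟨f, hf₂⟩ ≤ C * π.testNorm μ g₁ ⟨f, hf₁⟩ := by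
  obtain ⟨C, hC, h₁₂⟩ := UnitaryRep.exists_lintegral_wavelet_le hπ.1 hg₁ hg₁_ne hg₂ hg₂_ne
  obtain ⟨D, hD, h₂₁⟩ := UnitaryRep.exists_lintegral_wavelet_le hπ.1 hg₂ hg₂_ne hg₁ hg₁_ne
  refine ⟨le_antisymm (fun f hf => (h₁₂ f hf).1) fun f hf => (h₂₁ f hf).1,
    D⁻¹, C, inv_pos.2 hD, hC, fun f hf₁ hf₂ => ⟨?_, (h₁₂ f hf₁).2⟩⟩
  rw [inv_mul_le_iff₀ hD]
  exact (h₂₁ f hf₂).2
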